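/- For complex numbers $a_1,\dots,a_n$ ($n\ge 1$) put $$M_n(a_1,\dots,a_n)=\begin{pmatrix}a_n&-1\\1&0\end{pmatrix}\begin{pmatrix}a_{n-1}&-1\\1&0\end{pmatrix}\cdots\begin{pmatrix}a_1&-1\\1&0\end{pmatrix}.$$ Let $R\subseteq\mathbb{C}$ be closed under addition. A *$\lambda$-quiddity over $R$* of size $n\ge 1$ is a tuple $(a_1,\dots,a_n)\in R^n$ with $M_n(a_1,\dots,a_n)=\pm\mathrm{Id}$. For tuples of size $n,m\ge 2$ put $$(a_1,\dots,a_n)\oplus(b_1,\dots,b_m)=(a_1+b_m,a_2,\dots,a_{n-1},a_n+b_1,b_2,\dots,b_{m-1}),$$ a tuple of size $n+m-2$, and write $(a_1,\dots,a_n)\sim(b_1,\dots,b_n)$ if $(b_1,\dots,b_n)$ is a circular permutation of $(a_1,\dots,a_n)$ or of $(a_n,\dots,a_1)$. A $\lambda$-quiddity $c$ over $R$ of size at least $3$ is *reducible* over $R$ if $c\sim a\oplus b$ for some tuple $a$ of elements of $R$ of size at least $3$ and some $\lambda$-quiddity $b$ over $R$ of size at least $3$; it is *irreducible* over $R$ if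 it is not reducible. (Irreducible $\lambda$-quiddities thus have size at least $3$; in particular $(0,0)$ is not regarded as irreducible.) For $w\in\mathbb{C}$ let $\langle w\rangle=\mathbb{Z}w$. **Theorem.** Let $k\in\mathbb{N}=\{0,1,2,\dots\}$. The set of irreducible $\lambda$-quiddities over $\langle\sqrt{k}\rangle$ is 1. $\{(0,0,0,0)\}$ if $k=0$; 2. $\{(1,1,1),\,(-1,-1,-1)\}\cup\{(0,a,0,-a),\,(a,0,-a,0) : a\in\mathbb{Z}\setminus\{1,-1\}\}$ if $k=1$; 3. $\{(\sqrt2,\sqrt2,\sqrt2,\sqrt2),\,(-\sqrt2,-\sqrt2,-\sqrt2,-\sqrt2)\}\cup\{(0,a\sqrt2,0,-a\sqrt2),\,(a\sqrt2,0,-a\sqrt2,0) : a\in\mathbb{Z}\}$ if $k=2$; 4. $\{(\sqrt3,\sqrt3,\sqrt3,\sqrt3,\sqrt3,\sqrt3),\,(-\sqrt3,-\sqrt3,-\sqrt3,-\sqrt3,-\sqrt3,-\sqrt3)\}\cup\{(0,a\sqrt3,0,-a\sqrt3),\,(a\sqrt3,0,-a\sqrt3,0) : a\in\mathbb{Z}\}$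 if $k=3$; 5. $\{(0,a\sqrt k,0,-a\sqrt k),\,(a\sqrt k,0,-a\sqrt k,0) : a\in\mathbb{Z}\}$ if $k\ge 4$. -/

import Mathlib

namespace Quiddity

/-- The matrix `(a, -1; 1, 0)`. -/
def stepMatrix (a : ℂ) : Matrix (Fin 2) (Fin 2) ℂ :=
  !![a, -1; 1, 0]

/-- `M_n(a₁, …, aₙ)`, the product of the step matrices in the order `aₙ, …, a₁`. -/
def quiddityMatrix (a : List ℂ) : Matrix (Fin 2) (Fin 2) ℂ :=
  (a.reverse.map stepMatrix).prod

/-- A `λ`-quiddity over `R`: a tuple of positive size with entries in `R` and matrix `± Id`. -/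
def IsQuiddity (R : AddSubsemigroup ℂ) (c : List ℂ) : Prop :=
  c ≠ [] ∧ (∀ x ∈ c, x ∈ R) ∧ (quiddityMatrix c = 1 ∨ quiddityMatrix c = -1)

/-- The sum
`(a₁, …, aₙ) ⊕ (b₁, …, bₘ) = (a₁ + bₘ, a₂, …, aₙ₋₁, aₙ + b₁, b₂, …, bₘ₋₁)`.
It is only used for tuples of size at least `3`. -/
def oplus (a b : List ℂ) : List ℂ :=
  (a.headD 0 + b.getLastD 0) :: a.tail.dropLast ++ (a.getLastD 0 + b.headD 0) :: b.tail.dropLast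

/-- `b` is a circular permutation of `a` or of the reversal of `a`. -/
def Equivalent (a b : List ℂ) : Prop :=
  a.IsRotated b ∨ a.reverse.IsRotated b

/-- A `λ`-quiddity `c` over `R` of size at least `3` is reducible if it is equivalent to `a ⊕ b`
where `a` is a tuple over `R`, `b` is a `λ`-quiddity over `R` and both have size at least `3`. -/
def IsReducible (R : AddSubsemigroup ℂ) (c : List ℂ) : Prop :=
  IsQuiddity R c ∧ 3 ≤ c.length ∧
    ∃ a b : List ℂ, (∀ x ∈ a, x ∈ R) ∧ IsQuiddity R b ∧ 3 ≤ a.length ∧ 3 ≤ b.length ∧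
      Equivalent c (oplus a b)

/-- Irreducible `λ`-quiddities have size at least `3`: by convention `(0, 0)` is not irreducible. -/
def IsIrreducible (R : AddSubsemigroup ℂ) (c : List ℂ) : Prop :=
  IsQuiddity R c ∧ 3 ≤ c.length ∧ ¬ IsReducible R c

/-- The set `ℤ w`, that is, the subgroup of `(ℂ, +)` generated by `w`. -/
def cyclic (w : ℂ) : AddSubsemigroup ℂ :=
  (AddSubgroup.zmultiples w).toAddSubmonoid.toAddSubsemigroup

end Quiddity

/-!
The entry `M_{00}` of `M_n(a₁, …, aₙ)` is the product of the values of the continued fractions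
`aᵢ - 1 / (aᵢ₊₁ - 1 / ⋯)` of the suffixes, and since `M_{01} = 0` some suffix of a quiddity has
value `0`. If all entries have modulus at least `2`, all these values have modulus at least `1`, so
over `ℤ w` with `2 ≤ |w|` every quiddity has a zero entry; a zero entry splits off
`(-x, 0, x, 0)` as soon as the size is at least `5`.

The numbers `1`, `√2`, `√3` are `w = 2 cos (π / N)` for `N = 3, 4, 6`. The list of `j` entries `w`
has continued fraction `sin ((j + 1) π / N) / sin (j π / N)`, which is at least `1 / w` as long as
`j ≤ N - 2`, and its matrix is `-1` for `j = N`. Comparing with these values, a list of nonzero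
multiples of `w` without `N - 2` consecutive entries `w` or `-w` has nonzero continued fraction. So
a quiddity without zero entry contains such a block, which splits off the quiddity of size `N` with
constant entries `± w`.
-/

namespace Quiddity

open List Real

variable {R : AddSubsemigroup ℂ} {c l r t : List ℂ} {u v w x y z : ℂ}

lemma mem_cyclic : x ∈ cyclic w ↔ ∃ n : ℤ, (n : ℂ) * w = x := by
  change x ∈ AddSubgroup.zmultiples w ↔ _
  simp only [AddSubgroup.mem_zmultiples_iff, zsmul_eq_mul]

lemma self_mem_cyclic (w : ℂ) : w ∈ cyclic w :=
  mem_cyclic.2 ⟨1, by simp⟩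

lemma neg_mem_cyclic : ∀ x ∈ cyclic w, -x ∈ cyclic w :=
  fun _ hx => (AddSubgroup.zmultiples w).neg_mem hx

lemma mul_eq_neg_one_comm {n S : Type*} [Fintype n] [DecidableEq n] [CommRing S]
    {A B : Matrix n n S} : A * B = -1 ↔ B * A = -1 := by
  rw [← neg_eq_iff_eq_neg, ← neg_eq_iff_eq_neg, ← neg_mul, mul_eq_one_comm, mul_neg]

lemma eq_or_eq_neg_of_mul_eq_one_or_neg_one {n S : Type*} [Fintype n] [DecidableEq n]
    [CommRing S] {A X Y : Matrix n n S} (hX : X * A = 1 ∨ X * A = -1)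
    (hY : Y * A = 1 ∨ Y * A = -1) : X = Y ∨ X = -Y := by
  have hA : IsUnit A := by
    rcases hY with hY | hY
    · exact IsUnit.of_mul_eq_one_right Y hY
    · exact IsUnit.of_mul_eq_one_right (-Y) (by rw [neg_mul, hY, neg_neg])
  rw [← hA.mul_left_inj, ← hA.mul_left_inj (b := X), neg_mul]
  rcases hX with hX | hX <;> rcases hY with hY | hY <;> simp [hX, hY]

lemma quiddityMatrix_nil : quiddityMatrix [] = 1 := rfl

lemma quiddityMatrix_append (l m : List ℂ) :
    quiddityMatrix (l ++ m) = quiddityMatrix m * quiddityMatrix l := by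
  simp only [quiddityMatrix, reverse_append, map_append, prod_append]

lemma quiddityMatrix_cons (a : ℂ) (l : List ℂ) :
    quiddityMatrix (a :: l) = quiddityMatrix l * stepMatrix a := by
  simp [quiddityMatrix]

lemma quiddityMatrix_pair (x y : ℂ) : quiddityMatrix [x, y] = !![x * y - 1, -y; x, -1] := by
  simp [quiddityMatrix, stepMatrix, mul_comm, sub_eq_add_neg]

lemma quiddityMatrix_triple (x y z : ℂ) :
    quiddityMatrix [x, y, z] = !![(x * y - 1) * z - x, 1 - y * z; x * y - 1, -y] := by
  rw [quiddityMatrix_cons, quiddityMatrix_pair]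
  ext i j
  fin_cases i <;> fin_cases j <;> simp [stepMatrix, Matrix.mul_apply] <;> ring

lemma quiddityMatrix_quadruple (x₁ x₂ x₃ x₄ : ℂ) :
    quiddityMatrix [x₁, x₂, x₃, x₄] =
      !![(x₁ * x₂ - 1) * (x₃ * x₄ - 1) - x₁ * x₄, -x₂ * (x₃ * x₄ - 1) + x₄;
        (x₁ * x₂ - 1) * x₃ - x₁, 1 - x₂ * x₃] := by
  rw [quiddityMatrix_cons, quiddityMatrix_triple]
  ext i j
  fin_cases i <;> fin_cases j <;> simp [stepMatrix, Matrix.mul_apply] <;> ring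

lemma quiddityMatrix_map_neg (l : List ℂ) :
    quiddityMatrix (l.map (-·)) = (-1) ^ l.length •
      !![quiddityMatrix l 0 0, -quiddityMatrix l 0 1;
        -quiddityMatrix l 1 0, quiddityMatrix l 1 1] := by
  induction l with
  | nil => simp [quiddityMatrix_nil, Matrix.one_fin_two]
  | cons a l ih =>
    rw [map_cons, quiddityMatrix_cons, ih, quiddityMatrix_cons]
    ext i j
    fin_cases i <;> fin_cases j <;>
      simp [stepMatrix, Matrix.mul_apply, pow_succ] <;> ring

lemma IsQuiddity.of_isRotated (h : IsQuiddity R c) (hr : c ~r l) : IsQuiddity R l := by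
  obtain ⟨hne, hmem, hM⟩ := h
  refine ⟨fun hl => hne (isRotated_nil_iff.1 (hl ▸ hr)), fun x hx => hmem x (hr.mem_iff.2 hx), ?_⟩
  obtain ⟨n, rfl⟩ := hr
  rw [← take_append_drop (n % c.length) c, quiddityMatrix_append] at hM
  rw [rotate_eq_drop_append_take_mod, quiddityMatrix_append]
  exact hM.imp mul_eq_one_comm.1 mul_eq_neg_one_comm.1

lemma Equivalent.length_eq (h : Equivalent c l) : c.length = l.length := by
  rcases h with h | h
  · exact h.perm.length_eq
  · simpa using h.perm.length_eq

lemma Equivalent.mem_iff (h : Equivalent c l) : x ∈ c ↔ x ∈ l := by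
  rcases h with h | h
  · exact h.mem_iff
  · simpa using h.mem_iff (a := x)

lemma exists_eq_cons_append_singleton (h : 2 ≤ l.length) :
    ∃ x t y, l = x :: t ++ [y] := by
  obtain ⟨x, m, rfl⟩ := exists_cons_of_length_pos (show 0 < l.length by lia)
  have hm : m ≠ [] := by rintro rfl; simp at h
  exact ⟨x, m.dropLast, m.getLast hm, by simp [dropLast_append_getLast]⟩

lemma oplus_cons_append_singleton (x y u v : ℂ) (s t : List ℂ) :
    oplus (x :: s ++ [y]) (u :: t ++ [v]) = (x + v) :: s ++ (y + u) :: t := by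
  simp [oplus, getLastD_eq_getLast?, getLast?_append, getLast?_cons]

lemma exists_isRotated_append_of_infix (h : t <:+: c) : ∃ r, c ~r t ++ r := by
  obtain ⟨p, q, rfl⟩ := h
  exact ⟨q ++ p, by simpa using isRotated_append (l := p) (l' := t ++ q)⟩

/- Cut `c` after the block `t`, and subtract the two outer entries of the quiddity from the
neighbours of the block to obtain the other summand. -/
lemma IsQuiddity.isReducible_of_isRotated (hR : ∀ x ∈ R, -x ∈ R) (hc : IsQuiddity R c)
    (h : c ~r t ++ r) (hb : IsQuiddity R (u :: t ++ [v])) (ht : t ≠ []) (hr : 3 ≤ r.length) :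
    IsReducible R c := by
  have hlen : c.length = t.length + r.length := by simpa using h.perm.length_eq
  have htl : 0 < t.length := length_pos_iff.2 ht
  have hmem : ∀ z ∈ r, z ∈ R := fun z hz => hc.2.1 z (h.mem_iff.2 (mem_append_right t hz))
  obtain ⟨x, s, y, rfl⟩ := exists_eq_cons_append_singleton (show 2 ≤ r.length by lia)
  refine ⟨hc, by lia, (x - v) :: s ++ [y - u], u :: t ++ [v], ?_, hb, by simpa using hr,
    by simp; lia, Or.inl ?_⟩
  · have hx : x - v ∈ R := sub_eq_add_neg x v ▸
      R.add_mem (hmem x (by simp)) (hR v (hb.2.1 v (by simp)))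
    have hy : y - u ∈ R := sub_eq_add_neg y u ▸
      R.add_mem (hmem y (by simp)) (hR u (hb.2.1 u (by simp)))
    grind
  · rw [oplus_cons_append_singleton, sub_add_cancel, sub_add_cancel]
    simpa using h.trans isRotated_append

lemma IsQuiddity.quiddityMatrix_interior_zero_zero (h : IsQuiddity R (u :: t ++ [z])) :
    quiddityMatrix t 0 0 = 1 ∨ quiddityMatrix t 0 0 = -1 := by
  have hrot : IsQuiddity R (t ++ [z, u]) :=
    h.of_isRotated (by simpa using isRotated_append (l := [u]) (l' := t ++ [z]))
  obtain ⟨-, -, hM⟩ := hrot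
  rw [quiddityMatrix_append, quiddityMatrix_pair] at hM
  rcases hM with hM | hM
  all_goals
    have h₀ := congrFun₂ hM 0 0
    have h₁ := congrFun₂ hM 1 0
    simp only [Matrix.mul_apply, Fin.sum_univ_two, Matrix.of_apply, Matrix.cons_val',
      Matrix.cons_val_fin_one, Matrix.cons_val_zero, Matrix.cons_val_one, Matrix.neg_apply,
      Matrix.one_apply, ↓reduceIte, one_ne_zero, neg_zero] at h₀ h₁
    grind

lemma IsQuiddity.isIrreducible_of_forall_ne (hc : IsQuiddity R c) (h3 : 3 ≤ c.length)
    (h : ∀ t ≠ [], t.length + 3 ≤ c.length → t ⊆ c →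
      quiddityMatrix t 0 0 ≠ 1 ∧ quiddityMatrix t 0 0 ≠ -1) : IsIrreducible R c := by
  refine ⟨hc, h3, ?_⟩
  rintro ⟨-, -, a, b, -, hb, ha3, hb3, heq⟩
  obtain ⟨x, s, y, rfl⟩ := exists_eq_cons_append_singleton (show 2 ≤ a.length by lia)
  obtain ⟨u, t, v, rfl⟩ := exists_eq_cons_append_singleton (show 2 ≤ b.length by lia)
  rw [oplus_cons_append_singleton] at heq
  have hlen := heq.length_eq
  simp only [length_append, length_cons, length_nil] at ha3 hb3 hlen
  have ht : t ⊆ c := fun r hr => heq.mem_iff.2 (by simp [hr])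
  have hne := h t (length_pos_iff.1 (by lia)) (by lia) ht
  exact hb.quiddityMatrix_interior_zero_zero.elim hne.1 hne.2

lemma eq_pair_of_quiddityMatrix_eq (hv : v ≠ 0) (hr : r.length ≤ 2)
    (h : quiddityMatrix r = quiddityMatrix [v, v] ∨ quiddityMatrix r = -quiddityMatrix [v, v]) :
    r = [v, v] := by
  rw [quiddityMatrix_pair] at h
  match r, hr with
  | [], _ => simp [quiddityMatrix_nil, Matrix.one_fin_two, hv] at h
  | [x], _ => simp [quiddityMatrix, stepMatrix] at h
  | [x, y], _ =>
    rw [quiddityMatrix_pair] at h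
    simp only [Matrix.neg_of, Matrix.neg_cons, Matrix.neg_empty, EmbeddingLike.apply_eq_iff_eq,
      Matrix.vecCons_inj, and_true] at h
    grind

lemma IsIrreducible.eq_replicate_of_infix (hR : ∀ x ∈ R, -x ∈ R) (hc : IsIrreducible R c)
    {n : ℕ} (hn : n ≠ 0) (hv : v ≠ 0) (hq : IsQuiddity R (replicate (n + 2) v))
    (h : replicate n v <:+: c) : c = replicate (n + 2) v := by
  obtain ⟨hcq, -, hcr⟩ := hc
  obtain ⟨r, hr⟩ := exists_isRotated_append_of_infix h
  have hq' : IsQuiddity R (v :: replicate n v ++ [v]) := by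
    rwa [← replicate_succ, ← replicate_succ']
  have hr2 : r.length ≤ 2 := by
    by_contra! hr3
    exact hcr (hcq.isReducible_of_isRotated hR hr hq' (by simpa using hn) hr3)
  have hMr := (hcq.of_isRotated hr).2.2
  have hMv : quiddityMatrix (replicate n v ++ [v, v]) = 1 ∨
      quiddityMatrix (replicate n v ++ [v, v]) = -1 := by
    have := hq.2.2
    rwa [replicate_add] at this
  rw [quiddityMatrix_append] at hMr hMv
  obtain rfl := eq_pair_of_quiddityMatrix_eq hv hr2
    (eq_or_eq_neg_of_mul_eq_one_or_neg_one hMr hMv)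
  exact perm_replicate.1 (replicate_add n 2 v ▸ hr.perm)

lemma isQuiddity_zero_alternating (hR : ∀ x ∈ R, -x ∈ R) (hx : x ∈ R) :
    IsQuiddity R [0, x, 0, -x] := by
  have h0 : (0 : ℂ) ∈ R := add_neg_cancel x ▸ R.add_mem hx (hR x hx)
  refine ⟨by simp, by simp [hx, hR, h0], Or.inl ?_⟩
  simp [quiddityMatrix, stepMatrix, Matrix.one_fin_two]

lemma isQuiddity_alternating_zero (hR : ∀ x ∈ R, -x ∈ R) (hx : x ∈ R) :
    IsQuiddity R [x, 0, -x, 0] :=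
  (isQuiddity_zero_alternating hR hx).of_isRotated ⟨1, rfl⟩

lemma IsQuiddity.isReducible_of_zero_mem (hR : ∀ x ∈ R, -x ∈ R) (hc : IsQuiddity R c)
    (h0 : (0 : ℂ) ∈ c) (h5 : 5 ≤ c.length) : IsReducible R c := by
  obtain ⟨r, hr⟩ := exists_isRotated_append_of_infix ((singleton_infix_iff _ _).2 h0)
  have hlen : c.length = 1 + r.length := by simpa [add_comm] using hr.perm.length_eq
  obtain ⟨x, r, rfl⟩ := exists_cons_of_length_pos (show 0 < r.length by lia)
  have hx : x ∈ R := hc.2.1 x (hr.mem_iff.2 (by simp))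
  have hb : IsQuiddity R [-x, 0, x, 0] := by
    simpa using isQuiddity_alternating_zero hR (hR x hx)
  exact hc.isReducible_of_isRotated (t := [0, x]) hR hr hb (by simp) (by simp at hlen; lia)

lemma zero_notMem_of_quiddityMatrix_triple
    (h : quiddityMatrix [x, y, z] = 1 ∨ quiddityMatrix [x, y, z] = -1) :
    (0 : ℂ) ∉ [x, y, z] := by
  have hxy : x * y = 1 ∧ y * z = 1 := by
    simp only [quiddityMatrix_triple, Matrix.one_fin_two, Matrix.neg_of, Matrix.neg_cons,
      Matrix.neg_empty, EmbeddingLike.apply_eq_iff_eq, Matrix.vecCons_inj, and_true] at h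
    grind
  grind

lemma eq_alternating_of_quiddityMatrix_quadruple {x₁ x₂ x₃ x₄ : ℂ}
    (h : quiddityMatrix [x₁, x₂, x₃, x₄] = 1 ∨ quiddityMatrix [x₁, x₂, x₃, x₄] = -1)
    (h0 : (0 : ℂ) ∈ [x₁, x₂, x₃, x₄]) :
    [x₁, x₂, x₃, x₄] = [0, x₂, 0, -x₂] ∨ [x₁, x₂, x₃, x₄] = [x₁, 0, -x₁, 0] := by
  have hx : (x₁ * x₂ = 0 ∧ x₃ = -x₁ ∧ x₄ = -x₂) ∨ (x₁ * x₂ = 2 ∧ x₃ = x₁ ∧ x₄ = x₂) := by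
    simp only [quiddityMatrix_quadruple, Matrix.one_fin_two, Matrix.neg_of, Matrix.neg_cons,
      Matrix.neg_empty, EmbeddingLike.apply_eq_iff_eq, Matrix.vecCons_inj, and_true] at h
    grind
  grind

lemma isQuiddity_replicate_three (hv : v = 1 ∨ v = -1) (hvR : v ∈ R) :
    IsQuiddity R (replicate 3 v) := by
  refine ⟨by simp, by simpa using hvR, ?_⟩
  rcases hv with rfl | rfl <;> simp [quiddityMatrix, stepMatrix, Matrix.one_fin_two]

lemma IsIrreducible.exists_eq_alternating (hR : ∀ x ∈ R, -x ∈ R) (hc : IsIrreducible R c)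
    (h0 : (0 : ℂ) ∈ c) :
    ∃ x ∈ R, x ≠ 1 ∧ x ≠ -1 ∧ (c = [0, x, 0, -x] ∨ c = [x, 0, -x, 0]) := by
  obtain ⟨x, hx, hcx⟩ : ∃ x ∈ c, c = [0, x, 0, -x] ∨ c = [x, 0, -x, 0] := by
    have h5 : c.length < 5 := by
      by_contra! h5
      exact hc.2.2 (hc.1.isReducible_of_zero_mem hR h0 h5)
    match c, hc.2.1, h5 with
    | [_, _, _], _, _ => exact absurd h0 (zero_notMem_of_quiddityMatrix_triple hc.1.2.2)
    | [x₁, x₂, _, _], _, _ =>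
      rcases eq_alternating_of_quiddityMatrix_quadruple hc.1.2.2 h0 with h | h
      · exact ⟨x₂, by simp, Or.inl h⟩
      · exact ⟨x₁, by simp, Or.inr h⟩
  have hxR : x ∈ R := hc.1.2.1 x hx
  have hx1 : ¬ (x = 1 ∨ x = -1) := by
    intro h
    have hreplicate := hc.eq_replicate_of_infix (n := 1) (v := x) hR one_ne_zero (by grind)
      (isQuiddity_replicate_three h hxR) ((singleton_infix_iff _ _).2 hx)
    rcases hcx with rfl | rfl <;> simp [replicate_succ] at hreplicate
  push Not at hx1
  exact ⟨x, hxR, hx1.1, hx1.2, hcx⟩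

lemma isIrreducible_of_eq_alternating (hR : ∀ x ∈ R, -x ∈ R) (hxR : x ∈ R) (hx₁ : x ≠ 1)
    (hx₂ : x ≠ -1) (hcx : c = [0, x, 0, -x] ∨ c = [x, 0, -x, 0]) : IsIrreducible R c := by
  have hq : IsQuiddity R c := by
    rcases hcx with rfl | rfl
    · exact isQuiddity_zero_alternating hR hxR
    · exact isQuiddity_alternating_zero hR hxR
  have h4 : c.length = 4 := by rcases hcx with rfl | rfl <;> rfl
  refine hq.isIrreducible_of_forall_ne (by lia) fun t ht htl htc => ?_
  obtain ⟨y, rfl⟩ := length_eq_one_iff.1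
    (show t.length = 1 by have := length_pos_iff.2 ht; lia)
  have hy : y ∈ c := htc (by simp)
  have hM : quiddityMatrix [y] 0 0 = y := by simp [quiddityMatrix, stepMatrix]
  rcases hcx with rfl | rfl <;> grind

theorem isIrreducible_and_zero_mem_iff (hR : ∀ x ∈ R, -x ∈ R) :
    IsIrreducible R c ∧ (0 : ℂ) ∈ c ↔
      ∃ x ∈ R, x ≠ 1 ∧ x ≠ -1 ∧ (c = [0, x, 0, -x] ∨ c = [x, 0, -x, 0]) := by
  constructor
  · rintro ⟨hc, h0⟩
    exact hc.exists_eq_alternating hR h0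
  · rintro ⟨x, hxR, hx₁, hx₂, hcx⟩
    exact ⟨isIrreducible_of_eq_alternating hR hxR hx₁ hx₂ hcx,
      by rcases hcx with rfl | rfl <;> simp⟩

section ContFrac

variable {K : Type*} [Field K]

/-- The value of the continued fraction `a₁ - 1 / (a₂ - 1 / (⋯ - 1 / aₙ))` of the list
`[a₁, …, aₙ]`. The value at `[]`, which should be `∞`, is encoded as `0`: only its inverse
occurs in the recursion, and `0⁻¹ = 0`. -/
def contFrac : List K → K
  | [] => 0
  | a :: l => a - (contFrac l)⁻¹

lemma contFrac_map {L : Type*} [Field L] (f : K →+* L) (l : List K) :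
    contFrac (l.map f) = f (contFrac l) := by
  induction l with
  | nil => simp [contFrac]
  | cons a l ih => simp [contFrac, ih]

lemma contFrac_map_neg (l : List K) : contFrac (l.map (-·)) = -contFrac l := by
  induction l with
  | nil => simp [contFrac]
  | cons a l ih => simp only [map_cons, contFrac, ih, inv_neg]; ring

lemma quiddityMatrix_zero_zero_ne_zero_and_zero_one_eq (h : ∀ t ≠ [], t <:+ l → contFrac t ≠ 0) :
    quiddityMatrix l 0 0 ≠ 0 ∧
      quiddityMatrix l 0 1 = -(quiddityMatrix l 0 0 * (contFrac l)⁻¹) := by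
  induction l with
  | nil => simp [quiddityMatrix_nil, contFrac]
  | cons a l ih =>
    obtain ⟨h₀, h₁⟩ := ih fun t ht hl => h t ht (hl.trans (suffix_cons a l))
    have hne : contFrac (a :: l) ≠ 0 := h _ (cons_ne_nil a l) suffix_rfl
    have hrow : quiddityMatrix (a :: l) 0 0 = quiddityMatrix l 0 0 * contFrac (a :: l) ∧
        quiddityMatrix (a :: l) 0 1 = -quiddityMatrix l 0 0 := by
      rw [quiddityMatrix_cons]
      simp [stepMatrix, Matrix.mul_apply, h₁, contFrac]
      ring
    rw [hrow.1, hrow.2, mul_assoc, mul_inv_cancel₀ hne, mul_one]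
    exact ⟨mul_ne_zero h₀ hne, rfl⟩

lemma IsQuiddity.exists_suffix_contFrac_eq_zero (hc : IsQuiddity R c) :
    ∃ t ≠ [], t <:+ c ∧ contFrac t = 0 := by
  by_contra! h
  obtain ⟨h₀, h₁⟩ := quiddityMatrix_zero_zero_ne_zero_and_zero_one_eq h
  have hzero : quiddityMatrix c 0 1 = 0 := by rcases hc.2.2 with hM | hM <;> simp [hM]
  rw [hzero, eq_comm, neg_eq_zero] at h₁
  exact mul_ne_zero h₀ (inv_ne_zero (h c hc.1 suffix_rfl)) h₁

lemma one_le_norm_contFrac {K : Type*} [NormedField K] {l : List K} (hne : l ≠ [])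
    (h : ∀ a ∈ l, 2 ≤ ‖a‖) : 1 ≤ ‖contFrac l‖ := by
  induction l with
  | nil => exact absurd rfl hne
  | cons a l ih =>
    obtain ⟨ha, hl⟩ := forall_mem_cons.1 h
    have hinv : ‖(contFrac l)⁻¹‖ ≤ 1 := by
      rcases eq_or_ne l [] with rfl | hl'
      · simp [contFrac]
      · rw [norm_inv]
        exact inv_le_one_of_one_le₀ (ih hl' hl)
    calc 1 ≤ ‖a‖ - ‖(contFrac l)⁻¹‖ := by linarith
      _ ≤ ‖contFrac (a :: l)‖ := norm_sub_norm_le a _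

theorem IsQuiddity.exists_norm_lt_two (hc : IsQuiddity R c) : ∃ x ∈ c, ‖x‖ < 2 := by
  by_contra! h
  obtain ⟨t, ht, htc, h0⟩ := hc.exists_suffix_contFrac_eq_zero
  have hnorm := one_le_norm_contFrac ht fun a ha => h a (htc.subset ha)
  rw [h0, norm_zero] at hnorm
  exact not_lt_of_ge hnorm one_pos

end ContFrac

section Comparison

variable {K : Type*} [Field K] [LinearOrder K] {a w : K} {n : ℕ}
  {l t : List K}

/-- `RunFree w n l` says that every entry of `l` is `± w` or at least `2 w` in absolute value, and
that neither `w` nor `-w` occurs `n` times in a row in `l`. The continued fractions of such lists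
are controlled by those of the constant lists with entry `w`. -/
structure RunFree (w : K) (n : ℕ) (l : List K) : Prop where
  abs_eq_or_le : ∀ x ∈ l, |x| = w ∨ 2 * w ≤ |x|
  not_infix : ∀ v, |v| = w → ¬ replicate n v <:+: l

lemma RunFree.of_infix (h : RunFree w n l) (ht : t <:+: l) : RunFree w n t :=
  ⟨fun x hx => h.abs_eq_or_le x (ht.subset hx), fun v hv hr => h.not_infix v hv (hr.trans ht)⟩

lemma RunFree.map_neg (h : RunFree w n l) : RunFree w n (l.map (-·)) := by
  refine ⟨forall_mem_map.2 fun x hx => by simpa using h.abs_eq_or_le x hx, fun v hv hr => ?_⟩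
  refine h.not_infix (-v) (by rwa [abs_neg]) ?_
  simpa using hr.map (-·)

variable [IsStrictOrderedRing K]

lemma RunFree.not_prefix (hw : 0 < w) (h : RunFree w n l) : ¬ replicate n w <+: l :=
  fun hr => h.not_infix w (abs_of_pos hw) hr.isInfix

lemma RunFree.pos (hw : 0 < w) (h : RunFree w n l) : 0 < n := by
  by_contra! hn
  obtain rfl : n = 0 := by lia
  exact h.not_infix w (abs_of_pos hw) nil_infix

lemma contFrac_replicate_le (hw : 0 < w) (hn : ∀ j < n, w⁻¹ ≤ contFrac (replicate (j + 1) w))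
    {j : ℕ} (hj : j < n) : contFrac (replicate (j + 1) w) ≤ w := by
  rw [replicate_succ, contFrac, sub_le_self_iff, inv_nonneg]
  rcases j with - | i
  · exact le_rfl
  · exact (inv_pos.2 hw).le.trans (hn i (by lia))

lemma RunFree.contFrac_replicate_le_contFrac_cons (hw : 0 < w)
    (hn : ∀ j < n, w⁻¹ ≤ contFrac (replicate (j + 1) w)) (h : RunFree w n (a :: l)) (ha : 0 < a)
    (hl : ∀ j < n, ¬ replicate (j + 1) w <+: l →
      (contFrac l)⁻¹ ≤ (contFrac (replicate (j + 1) w))⁻¹)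
    {j : ℕ} (hj : j < n) (hpre : ¬ replicate (j + 1) w <+: a :: l) :
    contFrac (replicate (j + 1) w) ≤ contFrac (a :: l) := by
  have haw := h.abs_eq_or_le a mem_cons_self
  rw [abs_of_pos ha] at haw
  rcases haw with rfl | haw
  · rw [replicate_succ, cons_prefix_cons] at hpre
    obtain ⟨i, rfl⟩ : ∃ i, j = i + 1 :=
      Nat.exists_eq_succ_of_ne_zero (by rintro rfl; simp at hpre)
    rw [replicate_succ, contFrac, contFrac]
    exact sub_le_sub_left (hl i (by lia) fun h => hpre ⟨rfl, h⟩) a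
  · obtain ⟨m, rfl⟩ := Nat.exists_eq_add_one.2 (h.pos hw)
    have hlw : (contFrac l)⁻¹ ≤ w :=
      (hl m (by lia) ((h.of_infix (infix_cons infix_rfl)).not_prefix hw)).trans
        (inv_le_of_inv_le₀ hw (hn m (by lia)))
    calc contFrac (replicate (j + 1) w) ≤ w := contFrac_replicate_le hw hn hj
      _ ≤ a - (contFrac l)⁻¹ := by linarith

lemma RunFree.contFrac_cons_pos (hw : 0 < w)
    (hn : ∀ j < n, w⁻¹ ≤ contFrac (replicate (j + 1) w)) (h : RunFree w n (a :: l)) (ha : 0 < a)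
    (hl : ∀ j < n, ¬ replicate (j + 1) w <+: l →
      (contFrac l)⁻¹ ≤ (contFrac (replicate (j + 1) w))⁻¹) :
    0 < contFrac (a :: l) := by
  obtain ⟨m, rfl⟩ := Nat.exists_eq_add_one.2 (h.pos hw)
  calc 0 < w⁻¹ := inv_pos.2 hw
    _ ≤ contFrac (replicate (m + 1) w) := hn m (by lia)
    _ ≤ contFrac (a :: l) :=
      h.contFrac_replicate_le_contFrac_cons hw hn ha hl (by lia) (h.not_prefix hw)

lemma RunFree.ne_zero (hw : 0 < w) (h : RunFree w n l) {x : K} (hx : x ∈ l) : x ≠ 0 := by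
  rintro rfl
  have := h.abs_eq_or_le 0 hx
  grind

/- Lists with a negative first entry are reduced to their negatives, hence the induction on the
length instead of on the list. -/
lemma RunFree.inv_contFrac_le (hw : 0 < w)
    (hn : ∀ j < n, w⁻¹ ≤ contFrac (replicate (j + 1) w)) (h : RunFree w n l) {j : ℕ} (hj : j < n)
    (hpre : ¬ replicate (j + 1) w <+: l) :
    (contFrac l)⁻¹ ≤ (contFrac (replicate (j + 1) w))⁻¹ := by
  have hpos : ∀ i < n, 0 < contFrac (replicate (i + 1) w) :=
    fun i hi => (inv_pos.2 hw).trans_le (hn i hi)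
  induction hlen : l.length generalizing l j with
  | zero =>
    rw [length_eq_zero_iff.1 hlen]
    simpa [contFrac] using (hpos j hj).le
  | succ m ih =>
    obtain ⟨a, t, rfl⟩ := exists_cons_of_length_pos (show 0 < l.length by lia)
    have ht := h.of_infix (infix_cons infix_rfl)
    rcases (h.ne_zero hw mem_cons_self).lt_or_gt with ha | ha
    · have hneg : 0 < contFrac ((a :: t).map (-·)) :=
        h.map_neg.contFrac_cons_pos hw hn (neg_pos.2 ha)
          fun i hi hi' => ih ht.map_neg hi hi' (by simpa using hlen)
      rw [contFrac_map_neg, neg_pos] at hneg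
      exact (inv_neg''.2 hneg).le.trans (inv_nonneg.2 (hpos j hj).le)
    · exact inv_anti₀ (hpos j hj) (h.contFrac_replicate_le_contFrac_cons hw hn ha
        (fun i hi hi' => ih ht hi hi' (by simpa using hlen)) hj hpre)

lemma RunFree.contFrac_ne_zero (hw : 0 < w)
    (hn : ∀ j < n, w⁻¹ ≤ contFrac (replicate (j + 1) w)) (h : RunFree w n l) (hne : l ≠ []) :
    contFrac l ≠ 0 := by
  obtain ⟨a, t, rfl⟩ := exists_cons_of_ne_nil hne
  have ht := h.of_infix (infix_cons infix_rfl)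
  rcases (h.ne_zero hw mem_cons_self).lt_or_gt with ha | ha
  · have hneg : 0 < contFrac ((a :: t).map (-·)) :=
      h.map_neg.contFrac_cons_pos hw hn (neg_pos.2 ha) fun _ => ht.map_neg.inv_contFrac_le hw hn
    rw [contFrac_map_neg, neg_pos] at hneg
    exact hneg.ne
  · exact (h.contFrac_cons_pos hw hn ha fun _ => ht.inv_contFrac_le hw hn).ne'

end Comparison

theorem IsQuiddity.exists_replicate_infix {w : ℝ} {n : ℕ} (hw : 0 < w)
    (hn : ∀ j < n, w⁻¹ ≤ contFrac (replicate (j + 1) w)) (hc : IsQuiddity (cyclic (w : ℂ)) c)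
    (h0 : (0 : ℂ) ∉ c) : ∃ v : ℂ, (v = w ∨ v = -w) ∧ replicate n v <:+: c := by
  by_contra! hrun
  have hreal : ∀ x ∈ c, x.im = 0 := fun x hx => by
    obtain ⟨m, rfl⟩ := mem_cyclic.1 (hc.2.1 x hx)
    simp
  lift c to List ℝ using hreal
  have hfree : RunFree w n c := by
    refine ⟨fun x hx => ?_, fun v hv hr => ?_⟩
    · obtain ⟨m, hm⟩ := mem_cyclic.1 (hc.2.1 x (mem_map_of_mem hx))
      obtain rfl : (m : ℝ) * w = x := by exact_mod_cast hm
      have hm0 : m ≠ 0 := by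
        rintro rfl
        exact h0 (mem_map.2 ⟨_, hx, by simp⟩)
      rw [abs_mul, abs_of_pos hw]
      rcases (Int.one_le_abs hm0).eq_or_lt with h1 | h2
      · exact Or.inl (by rw [← Int.cast_abs, ← h1, Int.cast_one, one_mul])
      · exact Or.inr (mul_le_mul_of_nonneg_right (by exact_mod_cast h2) hw.le)
    · refine hrun v ?_ (by simpa using hr.map Complex.ofReal)
      rcases eq_or_eq_neg_of_abs_eq hv with rfl | rfl <;> simp
  obtain ⟨t, ht, htc, hzero⟩ := hc.exists_suffix_contFrac_eq_zero
  obtain ⟨s, hs, rfl⟩ := suffix_map_iff.1 htc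
  have hzero' : contFrac s = 0 := by
    rw [← Complex.ofReal_eq_zero, ← Complex.ofRealHom_eq_coe, ← contFrac_map]
    exact hzero
  exact (hfree.of_infix hs.isInfix).contFrac_ne_zero hw hn (by simpa using ht) hzero'

section TwoCos

lemma sin_smul_quiddityMatrix_replicate_two_cos (θ : ℂ) (j : ℕ) :
    Complex.sin θ • quiddityMatrix (replicate j (2 * Complex.cos θ)) =
      !![Complex.sin ((j + 1) * θ), -Complex.sin (j * θ);
        Complex.sin (j * θ), -Complex.sin ((j - 1) * θ)] := by
  induction j with
  | zero => simp [quiddityMatrix_nil, Matrix.one_fin_two]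
  | succ j ih =>
    have h₀ : Complex.sin ((j + 1 + 1) * θ) =
        2 * Complex.cos θ * Complex.sin ((j + 1) * θ) - Complex.sin (j * θ) := by
      rw [show (j + 1 + 1) * θ = (j + 1) * θ + θ by ring,
        show j * θ = (j + 1) * θ - θ by ring, Complex.sin_add, Complex.sin_sub]
      ring
    have h₁ : Complex.sin ((j - 1) * θ) =
        2 * Complex.cos θ * Complex.sin (j * θ) - Complex.sin ((j + 1) * θ) := by
      rw [sub_one_mul, add_one_mul, Complex.sin_add, Complex.sin_sub]
      ring
    rw [replicate_succ, quiddityMatrix_cons, ← smul_mul_assoc, ih, h₁]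
    ext a b
    fin_cases a <;> fin_cases b <;> simp [stepMatrix, Matrix.mul_apply, h₀] <;> ring

variable {θ : ℝ} {N j : ℕ}

lemma contFrac_replicate_two_cos (h : ∀ i < j, Real.sin ((i + 1) * θ) ≠ 0) :
    contFrac (replicate j (2 * Real.cos θ)) = Real.sin ((j + 1) * θ) / Real.sin (j * θ) := by
  induction j with
  | zero => simp [contFrac]
  | succ j ih =>
    have hrec : Real.sin ((j + 2) * θ) = 2 * Real.cos θ * Real.sin ((j + 1) * θ) -
        Real.sin (j * θ) := by
      rw [mul_right_comm, Real.two_mul_sin_mul_cos]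
      ring_nf
    rw [replicate_succ, contFrac, ih fun i hi => h i (by lia), inv_div, eq_div_iff
      (by exact_mod_cast h j (by lia))]
    push_cast
    rw [sub_mul, div_mul_cancel₀ _ (h j (by lia)), ← hrec]
    ring_nf

lemma sin_mul_pi_div_pos (hj : 0 < j) (hjN : j < N) : 0 < Real.sin (j * (π / N)) := by
  have hN : (0 : ℝ) < N := by exact_mod_cast hj.trans hjN
  refine Real.sin_pos_of_pos_of_lt_pi (by positivity) ?_
  rw [mul_div_assoc', div_lt_iff₀ hN, mul_comm]
  exact mul_lt_mul_of_pos_left (by exact_mod_cast hjN) Real.pi_pos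

lemma sin_pi_div_lt_sin_mul_pi_div (hj : 1 < j) (hjN : j + 1 < N) :
    Real.sin (π / N) < Real.sin (j * (π / N)) := by
  have hN : (0 : ℝ) < N := by exact_mod_cast (Nat.zero_lt_succ j).trans hjN
  have hj1 : (1 : ℝ) < j := by exact_mod_cast hj
  have hjN' : (j + 1 : ℝ) * (π / N) < π := by
    rw [mul_div_assoc', div_lt_iff₀ hN, mul_comm]
    exact mul_lt_mul_of_pos_left (by exact_mod_cast hjN) Real.pi_pos
  have hθ : 0 < π / N := by positivity
  have hjθ : π / N < j * (π / N) := lt_mul_of_one_lt_left hθ hj1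
  rw [← sub_pos, Real.sin_sub_sin]
  refine mul_pos (mul_pos two_pos ?_) ?_
  · exact Real.sin_pos_of_pos_of_lt_pi (by linarith) (by linarith)
  · exact Real.cos_pos_of_mem_Ioo ⟨by linarith, by linarith⟩

lemma two_cos_pi_div_pos (hN : 3 ≤ N) : 0 < 2 * Real.cos (π / N) := by
  have hlt : π / N < π / 2 :=
    div_lt_div_of_pos_left Real.pi_pos two_pos (by exact_mod_cast hN)
  have hpos : 0 ≤ π / N := by positivity
  exact mul_pos two_pos (Real.cos_pos_of_mem_Ioo ⟨by linarith, hlt⟩)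

lemma inv_two_cos_le_contFrac_replicate (hj : j + 3 ≤ N) :
    (2 * Real.cos (π / N))⁻¹ ≤ contFrac (replicate (j + 1) (2 * Real.cos (π / N))) := by
  have hpos (i : ℕ) (hi : i + 1 < N) : 0 < Real.sin ((i + 1) * (π / N)) := by
    exact_mod_cast sin_mul_pi_div_pos i.succ_pos hi
  have hrec : Real.sin ((j + 3) * (π / N)) = 2 * Real.cos (π / N) * Real.sin ((j + 2) * (π / N)) -
      Real.sin ((j + 1) * (π / N)) := by
    rw [mul_right_comm, Real.two_mul_sin_mul_cos]
    ring_nf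
  have hnonneg : 0 ≤ Real.sin ((j + 3) * (π / N)) := by
    refine Real.sin_nonneg_of_nonneg_of_le_pi (by positivity) ?_
    rw [mul_div_assoc', div_le_iff₀ (by exact_mod_cast (by lia : 0 < N)), mul_comm]
    exact mul_le_mul_of_nonneg_left (by exact_mod_cast hj) Real.pi_pos.le
  rw [contFrac_replicate_two_cos fun i hi => (hpos i (by lia)).ne', inv_eq_one_div,
    div_le_div_iff₀ (two_cos_pi_div_pos (by lia)) (by exact_mod_cast hpos j (by lia))]
  push_cast
  rw [add_assoc (j : ℝ) 1 1, one_add_one_eq_two]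
  linarith

lemma quiddityMatrix_replicate_two_cos (hN : 2 ≤ N) :
    quiddityMatrix (replicate N ((2 * Real.cos (π / N) : ℝ) : ℂ)) = -1 := by
  have hN0 : (N : ℂ) ≠ 0 := by exact_mod_cast (by lia : N ≠ 0)
  have hsin : Complex.sin (π / N) ≠ 0 := by
    exact_mod_cast (by simpa using (sin_mul_pi_div_pos one_pos hN).ne' : Real.sin (π / N) ≠ 0)
  have hNθ : (N : ℂ) * (π / N) = π := mul_div_cancel₀ _ hN0
  have h := sin_smul_quiddityMatrix_replicate_two_cos (π / N) N
  rw [add_mul, sub_mul, one_mul, hNθ, add_comm, Complex.sin_add_pi, Complex.sin_pi_sub,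
    Complex.sin_pi, neg_zero] at h
  push_cast
  refine smul_right_injective _ hsin (h.trans ?_)
  simp [Matrix.one_fin_two]

lemma isQuiddity_replicate_two_cos (hN : 2 ≤ N)
    (hv : v = (2 * Real.cos (π / N) : ℝ) ∨ v = -(2 * Real.cos (π / N) : ℝ)) (hvR : v ∈ R) :
    IsQuiddity R (replicate N v) := by
  refine ⟨by simp; lia, fun x hx => (mem_replicate.1 hx).2 ▸ hvR, ?_⟩
  rcases hv with rfl | rfl
  · exact Or.inr (quiddityMatrix_replicate_two_cos hN)
  · rw [← map_replicate (f := (-·)), quiddityMatrix_map_neg, quiddityMatrix_replicate_two_cos hN]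
    rcases neg_one_pow_eq_or ℤ N with h | h <;> simp [h, Matrix.one_fin_two]

lemma one_lt_quiddityMatrix_replicate_two_cos (hj : 0 < j) (hjN : j + 3 ≤ N) :
    ∃ x : ℝ, 1 < x ∧
      quiddityMatrix (replicate j ((2 * Real.cos (π / N) : ℝ) : ℂ)) 0 0 = x := by
  have hsin : 0 < Real.sin (π / N) := by
    simpa using sin_mul_pi_div_pos one_pos (by lia : 1 < N)
  have hlt := sin_pi_div_lt_sin_mul_pi_div (by lia : 1 < j + 1) (by lia : j + 1 + 1 < N)
  refine ⟨_, (one_lt_div hsin).2 hlt, ?_⟩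
  have h := congrFun₂ (sin_smul_quiddityMatrix_replicate_two_cos (π / N) j) 0 0
  have hne : Complex.sin (π / N) ≠ 0 := by exact_mod_cast hsin.ne'
  push_cast
  rw [eq_div_iff hne, mul_comm]
  simpa using h

lemma isIrreducible_replicate_two_cos (hN : 3 ≤ N)
    (hv : v = (2 * Real.cos (π / N) : ℝ) ∨ v = -(2 * Real.cos (π / N) : ℝ)) (hvR : v ∈ R) :
    IsIrreducible R (replicate N v) := by
  refine (isQuiddity_replicate_two_cos (by lia) hv hvR).isIrreducible_of_forall_ne
    (by simpa using hN) fun t ht htl htc => ?_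
  obtain ⟨j, rfl⟩ : ∃ j, t = replicate j v :=
    ⟨_, eq_replicate_length.2 fun x hx => eq_of_mem_replicate (htc hx)⟩
  obtain ⟨x, hx, hM⟩ := one_lt_quiddityMatrix_replicate_two_cos (N := N) (j := j)
    (by simpa [Nat.pos_iff_ne_zero] using ht) (by simpa using htl)
  have hM' : quiddityMatrix (replicate j v) 0 0 = x ∨ quiddityMatrix (replicate j v) 0 0 = -x := by
    rcases hv with rfl | rfl
    · exact Or.inl hM
    · rw [← map_replicate (f := (-·)), quiddityMatrix_map_neg]
      rcases neg_one_pow_eq_or ℤ j with h | h <;> simp_all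
  have hx1 : (x : ℂ) ≠ 1 ∧ (x : ℂ) ≠ -1 :=
    ⟨by exact_mod_cast hx.ne', by exact_mod_cast (by linarith : x > -1).ne'⟩
  grind

end TwoCos

section Cyclic

lemma isIrreducible_cyclic_and_zero_mem_iff :
    IsIrreducible (cyclic w) c ∧ (0 : ℂ) ∈ c ↔
      ∃ a : ℤ, a * w ≠ 1 ∧ a * w ≠ -1 ∧
        (c = [0, a * w, 0, -(a * w)] ∨ c = [a * w, 0, -(a * w), 0]) := by
  simp only [isIrreducible_and_zero_mem_iff neg_mem_cyclic, mem_cyclic, exists_exists_eq_and]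

theorem isIrreducible_cyclic_zero_iff : IsIrreducible (cyclic 0) c ↔ c = [0, 0, 0, 0] := by
  have h0 (hc : IsIrreducible (cyclic 0) c) : (0 : ℂ) ∈ c := by
    obtain ⟨x, hx⟩ := exists_mem_of_ne_nil c hc.1.1
    obtain ⟨n, rfl⟩ := mem_cyclic.1 (hc.1.2.1 x hx)
    simpa using hx
  rw [← and_iff_left_of_imp h0, isIrreducible_cyclic_and_zero_mem_iff]
  simp

lemma IsIrreducible.eq_replicate_of_zero_notMem {N : ℕ} (hN : 3 ≤ N)
    (hw : w = (2 * Real.cos (π / N) : ℝ)) (hc : IsIrreducible (cyclic w) c) (h0 : (0 : ℂ) ∉ c) :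
    c = replicate N w ∨ c = replicate N (-w) := by
  obtain ⟨n, rfl⟩ := Nat.exists_eq_add_of_le' (show 2 ≤ N by lia)
  have hpos := two_cos_pi_div_pos hN
  have hw0 : w ≠ 0 := by
    rw [hw]
    exact_mod_cast hpos.ne'
  obtain ⟨v, hv, hvc⟩ := (hw ▸ hc.1).exists_replicate_infix (n := n) hpos
    (fun j hj => inv_two_cos_le_contFrac_replicate (by lia)) h0
  have hvw : v = w ∨ v = -w := by rwa [hw]
  have hvR : v ∈ cyclic w := by
    rcases hvw with rfl | rfl
    · exact self_mem_cyclic v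
    · exact neg_mem_cyclic w (self_mem_cyclic w)
  have hv0 : v ≠ 0 := by rcases hvw with rfl | rfl <;> simpa using hw0
  have hcv := hc.eq_replicate_of_infix neg_mem_cyclic (by lia) hv0
    (isQuiddity_replicate_two_cos (by lia) hv hvR) hvc
  rcases hvw with rfl | rfl
  · exact Or.inl hcv
  · exact Or.inr hcv

theorem isIrreducible_cyclic_two_cos_iff {N : ℕ} (hN : 3 ≤ N)
    (hw : w = (2 * Real.cos (π / N) : ℝ)) :
    IsIrreducible (cyclic w) c ↔ (c = replicate N w ∨ c = replicate N (-w)) ∨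
      ∃ a : ℤ, a * w ≠ 1 ∧ a * w ≠ -1 ∧
        (c = [0, a * w, 0, -(a * w)] ∨ c = [a * w, 0, -(a * w), 0]) := by
  have hwR := self_mem_cyclic w
  rw [← isIrreducible_cyclic_and_zero_mem_iff]
  constructor
  · intro hc
    by_cases h0 : (0 : ℂ) ∈ c
    · exact Or.inr ⟨hc, h0⟩
    · exact Or.inl (hc.eq_replicate_of_zero_notMem hN hw h0)
  · rintro ((rfl | rfl) | ⟨hc, -⟩)
    · exact isIrreducible_replicate_two_cos hN (Or.inl hw) hwR
    · exact isIrreducible_replicate_two_cos hN (Or.inr (by rw [hw])) (neg_mem_cyclic w hwR)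
    · exact hc

theorem isIrreducible_cyclic_iff_of_two_le_norm (hw : 2 ≤ ‖w‖) :
    IsIrreducible (cyclic w) c ↔
      ∃ a : ℤ, c = [0, a * w, 0, -(a * w)] ∨ c = [a * w, 0, -(a * w), 0] := by
  have hnorm (a : ℤ) (ha : ‖a * w‖ < 2) : a = 0 := by
    by_contra ha0
    have : (1 : ℝ) ≤ |(a : ℝ)| := by exact_mod_cast Int.one_le_abs ha0
    rw [norm_mul, Complex.norm_intCast] at ha
    nlinarith
  have hone (a : ℤ) : a * w ≠ 1 ∧ a * w ≠ -1 := by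
    constructor <;> intro h <;> simp [hnorm a (by simp [h])] at h
  have h0 (hc : IsIrreducible (cyclic w) c) : (0 : ℂ) ∈ c := by
    obtain ⟨x, hx, hx2⟩ := hc.1.exists_norm_lt_two
    obtain ⟨a, rfl⟩ := mem_cyclic.1 (hc.1.2.1 x hx)
    simpa [hnorm a hx2] using hx
  rw [← and_iff_left_of_imp h0, isIrreducible_cyclic_and_zero_mem_iff]
  simp only [hone, true_and, ne_eq, not_false_eq_true]

end Cyclic

lemma intCast_mul_ne_one_and_ne_neg_one {S : Type*} [CommRing S] [CharZero S] {x : S} {m : ℤ}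
    (hx : x ^ 2 = m) (hm : ¬ IsUnit m) (a : ℤ) : a * x ≠ 1 ∧ a * x ≠ -1 := by
  have hsq : (a * x) ^ 2 ≠ 1 := by
    rw [mul_pow, hx]
    norm_cast
    exact fun h => hm (IsUnit.of_mul_eq_one_right _ h)
  constructor <;> intro h <;> simp [h] at hsq

theorem mainTheorem1_general :
    (∀ c, IsIrreducible (cyclic 0) c ↔ c = [0, 0, 0, 0]) ∧
    (∀ N : ℕ, 3 ≤ N → ∀ w : ℝ, w = 2 * Real.cos (π / N) →
      ∀ c, IsIrreducible (cyclic w) c ↔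
        (c = replicate N (w : ℂ) ∨ c = replicate N (-w : ℂ)) ∨
          ∃ a : ℤ, a * (w : ℂ) ≠ 1 ∧ a * (w : ℂ) ≠ -1 ∧
            (c = [0, a * (w : ℂ), 0, -(a * w)] ∨ c = [a * (w : ℂ), 0, -(a * w), 0])) ∧
    (∀ w : ℂ, 2 ≤ ‖w‖ →
      ∀ c, IsIrreducible (cyclic w) c ↔
        ∃ a : ℤ, c = [0, a * w, 0, -(a * w)] ∨ c = [a * w, 0, -(a * w), 0]) :=
  ⟨fun _ => isIrreducible_cyclic_zero_iff,
    fun _ hN _ hw _ => isIrreducible_cyclic_two_cos_iff hN (congrArg Complex.ofReal hw),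
    fun _ hw _ => isIrreducible_cyclic_iff_of_two_le_norm hw⟩

end Quiddity

theorem mainTheorem1 :
    ({c : List ℂ | Quiddity.IsIrreducible (Quiddity.cyclic ((√0 : ℝ) : ℂ)) c} =
      {[0, 0, 0, 0]}) ∧
    ({c : List ℂ | Quiddity.IsIrreducible (Quiddity.cyclic ((√1 : ℝ) : ℂ)) c} =
      {[1, 1, 1], [-1, -1, -1]} ∪
      {c : List ℂ | ∃ a : ℤ, a ≠ 1 ∧ a ≠ -1 ∧
        (c = [0, (a : ℂ), 0, -(a : ℂ)] ∨ c = [(a : ℂ), 0, -(a : ℂ), 0])}) ∧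
    ({c : List ℂ | Quiddity.IsIrreducible (Quiddity.cyclic ((√2 : ℝ) : ℂ)) c} =
      {[((√2 : ℝ) : ℂ), ((√2 : ℝ) : ℂ), ((√2 : ℝ) : ℂ), ((√2 : ℝ) : ℂ)],
       [-((√2 : ℝ) : ℂ), -((√2 : ℝ) : ℂ), -((√2 : ℝ) : ℂ), -((√2 : ℝ) : ℂ)]} ∪
      {c : List ℂ | ∃ a : ℤ,
        c = [0, a * ((√2 : ℝ) : ℂ), 0, -(a * ((√2 : ℝ) : ℂ))] ∨
        c = [a * ((√2 : ℝ) : ℂ), 0, -(a * ((√2 : ℝ) : ℂ)), 0]}) ∧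
    ({c : List ℂ | Quiddity.IsIrreducible (Quiddity.cyclic ((√3 : ℝ) : ℂ)) c} =
      {[((√3 : ℝ) : ℂ), ((√3 : ℝ) : ℂ), ((√3 : ℝ) : ℂ),
        ((√3 : ℝ) : ℂ), ((√3 : ℝ) : ℂ), ((√3 : ℝ) : ℂ)],
       [-((√3 : ℝ) : ℂ), -((√3 : ℝ) : ℂ), -((√3 : ℝ) : ℂ),
        -((√3 : ℝ) : ℂ), -((√3 : ℝ) : ℂ), -((√3 : ℝ) : ℂ)]} ∪
      {c : List ℂ | ∃ a : ℤ,
        c = [0, a * ((√3 : ℝ) : ℂ), 0, -(a * ((√3 : ℝ) : ℂ))] ∨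
        c = [a * ((√3 : ℝ) : ℂ), 0, -(a * ((√3 : ℝ) : ℂ)), 0]}) ∧
    (∀ k : ℕ, 4 ≤ k →
      {c : List ℂ | Quiddity.IsIrreducible (Quiddity.cyclic ((√(k : ℝ) : ℝ) : ℂ)) c} =
      {c : List ℂ | ∃ a : ℤ,
        c = [0, a * ((√(k : ℝ) : ℝ) : ℂ), 0, -(a * ((√(k : ℝ) : ℝ) : ℂ))] ∨
        c = [a * ((√(k : ℝ) : ℝ) : ℂ), 0, -(a * ((√(k : ℝ) : ℝ) : ℂ)), 0]}) := by
  obtain ⟨hzero, hcos, hnorm⟩ := Quiddity.mainTheorem1_general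
  refine ⟨Set.ext fun c => ?_, Set.ext fun c => ?_, Set.ext fun c => ?_, Set.ext fun c => ?_,
    fun k hk => Set.ext fun c => hnorm _ ?_ c⟩
  · simpa using hzero c
  · have hcast (a : ℤ) : (a : ℂ) = -1 ↔ a = -1 := by norm_cast
    simpa [List.replicate_succ, hcast] using hcos 3 le_rfl 1 (by simp) c
  · have hne := Quiddity.intCast_mul_ne_one_and_ne_neg_one (x := ((√2 : ℝ) : ℂ)) (m := 2)
      (by norm_cast; simp) (by decide)
    simpa [List.replicate_succ, hne] using hcos 4 (by lia) √2 (by simp; ring) c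
  · have hne := Quiddity.intCast_mul_ne_one_and_ne_neg_one (x := ((√3 : ℝ) : ℂ)) (m := 3)
      (by norm_cast; simp) (by decide)
    simpa [List.replicate_succ, hne] using hcos 6 (by lia) √3 (by simp; ring) c
  · rw [Complex.norm_real, Real.norm_of_nonneg (Real.sqrt_nonneg _)]
    exact Real.le_sqrt_of_sq_le (by norm_num; exact_mod_cast hk)
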